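/- Let $N\in\mathbb N$ and $p>0$ be fixed and write $\mathbb R_+=(0,\infty)$. For parameters $u\in\mathbb R^N$, $M\in\mathbb R^{N\times N}$, $\sigma\in\mathbb R^N$ consider the nonlinear Friedkin--Johnsen-type system $$\dot x_i=\sum_{j=1}^N M_{ij}(x_j-x_i)+\sigma_i(u_i-x_i^p)x_i,\qquad i=1,\dots,N, \tag{1}$$ and the game in which agent $i$ chooses a strategy $x_i\in\mathbb R_+$ so as to minimize the payout function $$p_i(x)=\frac12\sum_{j=1}^N M_{ij}(x_i-x_j)^2+\sigma_i\Bigl(\frac{1}{p+2}x_i^{p+2}-\frac12u_ix_i^2\Bigr).$$ A Nash equilibrium is a point $x\in\mathbb R_+^N$ such that, for every $i$, $p_i(x)\le p_i(x_1,\dots,x_{i-1},r,x_{i+1},\dots,x_N)$ for all $r\in\mathbb R_+$. Let $\mathcal P$ be the set of all $(u,M,\sigma)$ such that $u_i>0$, $M_{ij}=M_{ji}\ge0$ and $0\le\sigma_i<\infty$ for all $i,j$, and such that for every $i$ there are a $j$ with $\sigma_j>0$ and a path $i=i_0,i_1,\dots,i_k=j$ ($k\ge0$) with $M_{i_{l-1}i_l}>0$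 for $1\le l\le k$ (for instance: all $\sigma_i>0$; or the graph of the positive entries of $M$ is connected and some $\sigma_i>0$). Theorem. For every $(u,M,\sigma)\in\mathcal P$ there is a unique $x^*\in\mathbb R_+^N$ with $$\sum_{j=1}^N M_{ij}(x^*_j-x^*_i)+\sigma_i\bigl(u_i-(x_i^*)^p\bigr)x^*_i=0\qquad(i=1,\dots,N),$$ and it is a locally exponentially stable equilibrium of (1): there are $\delta,C,r>0$ such that every solution on $[0,\infty)$ with $\|x(0)-x^*\|<\delta$ satisfies $\|x(t)-x^*\|\le Ce^{-rt}\|x(0)-x^*\|$ for all $t\ge0$. The map $\mathcal P\to\mathbb R_+^N$, $(u,M,\sigma)\mapsto x^*$, is $C^\infty$, in the sense that it is the restriction to $\mathcal P$ of a $C^\infty$ map defined on an open neighbourhood of $\mathcal P$ in $\mathbb R^N\times\mathbb R^{N\times N}\times\mathbb R^N$. The point $x^*$ is the unique Nash equilibrium of the game. Finally, for every $x_0\in\mathbb R^N_+$ there is a solution of (1) on $[0,\infty)$ with $x(0)=x_0$, and every solution $x$ of (1) on $[0,\infty)$ with $x(0)\in\mathbb R^N_+$ stays in $\mathbb R_+^N$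 and satisfies $x(t)\to x^*$ as $t\to\infty$. -/

import Mathlib

open Set Filter Topology
open scoped ContDiff

namespace OpinionGame

/-- The parameters `(u, M, σ)`: convictions, coupling matrix, stubbornness. -/
abbrev Params (N : ℕ) : Type :=
  (Fin N → ℝ) × (Fin N → Fin N → ℝ) × (Fin N → ℝ)

/-- The open positive orthant of `ℝ^N`. -/
def positiveOrthant (N : ℕ) : Set (Fin N → ℝ) := {x | ∀ i, 0 < x i}

/-- Admissible parameters: positive convictions, a symmetric entrywise nonnegative coupling matrix,
nonnegative stubbornness, and every agent is connected, along positive entries of `M`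
(a path of length zero is allowed), to some agent with positive stubbornness. -/
def admissible (N : ℕ) : Set (Params N) :=
  {q | (∀ i, 0 < q.1 i) ∧
       (∀ i j, q.2.1 i j = q.2.1 j i) ∧
       (∀ i j, 0 ≤ q.2.1 i j) ∧
       (∀ i, 0 ≤ q.2.2 i) ∧
       (∀ i, ∃ j, Relation.ReflTransGen (fun a b => 0 < q.2.1 a b) i j ∧ 0 < q.2.2 j)}

/-- The right-hand side of the system,
`x ↦ (∑ j, M i j * (x j - x i) + σ i * (u i - x i ^ p) * x i)_i`. -/
noncomputable def field {N : ℕ} (p : ℝ) (q : Params N) (x : Fin N → ℝ) : Fin N → ℝ :=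
  fun i => ∑ j, q.2.1 i j * (x j - x i) + q.2.2 i * (q.1 i - x i ^ p) * x i

/-- The payout (cost) function of agent `i`, which agent `i` wants to minimize. -/
noncomputable def payout {N : ℕ} (p : ℝ) (q : Params N) (i : Fin N) (x : Fin N → ℝ) : ℝ :=
  (1 / 2) * ∑ j, q.2.1 i j * (x i - x j) ^ 2
    + q.2.2 i * (1 / (p + 2) * x i ^ (p + 2) - (1 / 2) * q.1 i * x i ^ 2)

/-- `x` is a positive steady state. -/
def IsPositiveSteadyState {N : ℕ} (p : ℝ) (q : Params N) (x : Fin N → ℝ) : Prop :=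
  x ∈ positiveOrthant N ∧ ∀ i, field p q x i = 0

/-- `x` is a Nash equilibrium of the game in which the strategies of each agent are the positive
reals: no agent can lower its own payout by a unilateral change of strategy. -/
def IsNashEquilibrium {N : ℕ} (p : ℝ) (q : Params N) (x : Fin N → ℝ) : Prop :=
  x ∈ positiveOrthant N ∧
    ∀ i, ∀ r : ℝ, 0 < r → payout p q i x ≤ payout p q i (Function.update x i r)

/-- `x` solves the autonomous equation `x' = f x` on `[0, ∞)` (one-sided derivative at `0`). -/
def IsSolution {N : ℕ} (f : (Fin N → ℝ) → (Fin N → ℝ)) (x : ℝ → Fin N → ℝ) : Prop :=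
  ∀ t : ℝ, 0 ≤ t → HasDerivWithinAt x (f (x t)) (Ici 0) t

/-- `z` is a locally exponentially stable equilibrium of `x' = f x`. -/
def IsLocallyExponentiallyStable {N : ℕ} (f : (Fin N → ℝ) → (Fin N → ℝ)) (z : Fin N → ℝ) : Prop :=
  f z = 0 ∧ ∃ δ C r : ℝ, 0 < δ ∧ 0 < C ∧ 0 < r ∧
    ∀ x : ℝ → Fin N → ℝ, IsSolution f x → ‖x 0 - z‖ < δ →
      ∀ t : ℝ, 0 ≤ t → ‖x t - z‖ ≤ C * Real.exp (-r * t) * ‖x 0 - z‖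

end OpinionGame

namespace OpinionGame

/-! Everything rests on one dissipation inequality. Subtracting `x i / z i` times the steady-state
equation at `z` removes `u`; with `w i = (x i - z i) / z i` and `M` symmetric, pairing the field
with `x - z` gives minus the sum of a Dirichlet form `M i j * z i * z j * (w i - w j) ^ 2` and a
monotone term in `x ^ p`. Connectedness to a stubborn agent makes this definite
(`exists_dissipation`). Uniqueness, invertibility of the linearization and exponential decay all
follow.

Existence comes from minimizing a potential on a cube (`exists_isPositiveSteadyState`). The implicit
function theorem gives smooth local branches, glued by a partition of unity, since uniqueness makes
them agree on admissible parameters.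

The same rewriting shows that the field points inward on the faces of the boxes from `a • z` to `b •
z` with `a ≤ 1 ≤ b`. This yields the Nash property as well as global solutions confined to a box,
where the dissipation constant is uniform. -/

/-! ### Quantitative positivity -/

theorem exists_pos_mul_norm_sq_le {E : Type*} [NormedAddCommGroup E] [NormedSpace ℝ E]
    [FiniteDimensional ℝ E] {Q : E → ℝ} (hQ : Continuous Q)
    (hhom : ∀ (s : ℝ) v, Q (s • v) = s ^ 2 * Q v) (hpos : ∀ v, v ≠ 0 → 0 < Q v) :
    ∃ c : ℝ, 0 < c ∧ ∀ v, c * ‖v‖ ^ 2 ≤ Q v := by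
  have h0 : Q 0 = 0 := by simpa using hhom 0 0
  rcases (Metric.sphere (0 : E) 1).eq_empty_or_nonempty with hS | hS
  · refine ⟨1, one_pos, fun v => ?_⟩
    by_cases hv : v = 0
    · simp [hv, h0]
    · have hmem : ‖v‖⁻¹ • v ∈ Metric.sphere (0 : E) 1 := by
        simp [norm_smul, norm_ne_zero_iff.2 hv]
      simp [hS] at hmem
  · obtain ⟨w, hw, hmin⟩ := (isCompact_sphere (0 : E) 1).exists_isMinOn hS hQ.continuousOn
    have hw0 : w ≠ 0 := by
      rintro rfl
      simp at hw
    refine ⟨Q w, hpos w hw0, fun v => ?_⟩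
    by_cases hv : v = 0
    · simp [hv, h0]
    · have hn : ‖v‖ ≠ 0 := norm_ne_zero_iff.2 hv
      have hmem : ‖v‖⁻¹ • v ∈ Metric.sphere (0 : E) 1 := by
        simp [norm_smul, hn]
      have h1 : Q w ≤ Q (‖v‖⁻¹ • v) := hmin hmem
      have h2 : Q v = ‖v‖ ^ 2 * Q (‖v‖⁻¹ • v) := by
        rw [← hhom, smul_smul, mul_inv_cancel₀ hn, one_smul]
      rw [h2, mul_comm]
      gcongr

theorem sum_sq_le_card_mul_norm_sq {N : ℕ} (v : Fin N → ℝ) : ∑ i, v i ^ 2 ≤ N * ‖v‖ ^ 2 := by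
  calc ∑ i, v i ^ 2 ≤ ∑ _i : Fin N, ‖v‖ ^ 2 := by
        refine Finset.sum_le_sum fun i _ => ?_
        rw [← sq_abs, ← Real.norm_eq_abs]
        gcongr
        exact norm_le_pi_norm v i
    _ = N * ‖v‖ ^ 2 := by simp

theorem norm_sq_le_sum_sq {N : ℕ} (v : Fin N → ℝ) : ‖v‖ ^ 2 ≤ ∑ i, v i ^ 2 := by
  have h : ‖v‖ ≤ √(∑ i, v i ^ 2) := by
    refine (pi_norm_le_iff_of_nonneg (Real.sqrt_nonneg _)).2 fun i => ?_
    rw [Real.norm_eq_abs]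
    exact Real.abs_le_sqrt
      (Finset.single_le_sum (f := fun i => v i ^ 2) (fun j _ => sq_nonneg (v j)) (Finset.mem_univ i))
  calc ‖v‖ ^ 2 ≤ √(∑ i, v i ^ 2) ^ 2 := by gcongr
    _ = _ := Real.sq_sqrt (Finset.sum_nonneg fun i _ => sq_nonneg _)

/-- Strict monotonicity of `x ↦ x ^ p`, uniformly on compact subsets of `(0, ∞)`. -/
theorem exists_pos_mul_sq_le_rpow_sub {p z a b : ℝ} (hp : 0 < p) (hz : 0 < z) (ha : 0 < a) :
    ∃ k : ℝ, 0 < k ∧ ∀ x, a ≤ x → x ≤ b → k * (x - z) ^ 2 ≤ (x ^ p - z ^ p) * (x - z) * x := by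
  -- The difference quotient, extended by the derivative at `z`, is continuous and positive on `(0,
  -- ∞)`; `k` is the minimum of `g x * x` on `[a, b]`.
  set g : ℝ → ℝ := dslope (fun x : ℝ => x ^ p) z with hg
  have hgc : ContinuousOn g (Ioi 0) := by
    rw [hg, continuousOn_dslope (Ioi_mem_nhds hz)]
    exact ⟨(Real.continuous_rpow_const hp.le).continuousOn,
      Real.differentiableAt_rpow_const_of_ne p hz.ne'⟩
  have hgpos : ∀ x, 0 < x → 0 < g x := by
    intro x hx
    rcases eq_or_ne x z with rfl | hne
    · rw [hg, dslope_same, (Real.hasDerivAt_rpow_const (Or.inl hx.ne')).deriv]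
      positivity
    · rw [hg, dslope_of_ne _ hne, slope_def_field]
      rcases lt_or_gt_of_ne hne with h | h
      · exact div_pos_of_neg_of_neg (sub_neg.2 (Real.rpow_lt_rpow hx.le h hp)) (sub_neg.2 h)
      · exact div_pos (sub_pos.2 (Real.rpow_lt_rpow hz.le h hp)) (sub_pos.2 h)
  rcases lt_or_ge b a with hab | hab
  · exact ⟨1, one_pos, fun x h1 h2 => absurd (h1.trans h2) (not_le.2 hab)⟩
  obtain ⟨w, hw, hmin⟩ := (isCompact_Icc (a := a) (b := b)).exists_isMinOn (nonempty_Icc.2 hab)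
    (f := fun x => g x * x)
    ((hgc.mono fun x hx => ha.trans_le hx.1).mul continuousOn_id)
  have hw0 : 0 < w := ha.trans_le hw.1
  refine ⟨g w * w, mul_pos (hgpos w hw0) hw0, fun x h1 h2 => ?_⟩
  have h3 : g w * w ≤ g x * x := hmin ⟨h1, h2⟩
  have h4 : (x - z) * g x = x ^ p - z ^ p := by
    simpa [smul_eq_mul] using sub_smul_dslope (fun x : ℝ => x ^ p) z x
  rw [← h4]
  nlinarith [mul_le_mul_of_nonneg_right h3 (sq_nonneg (x - z))]

/-! ### Dissipation and uniqueness -/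

theorem sum_symm_mul_sub {ι : Type*} [Fintype ι] {S : ι → ι → ℝ} (hS : ∀ i j, S i j = S j i)
    (v : ι → ℝ) :
    ∑ i, ∑ j, S i j * (v i * (v j - v i)) = -((1 / 2) * ∑ i, ∑ j, S i j * (v i - v j) ^ 2) := by
  have h : ∑ i, ∑ j, S i j * (v i * (v j - v i)) = ∑ i, ∑ j, S i j * (v j * (v i - v j)) := by
    rw [Finset.sum_comm]
    exact Finset.sum_congr rfl fun i _ => Finset.sum_congr rfl fun j _ => by rw [hS]
  have h2 : ∑ i, ∑ j, S i j * (v i * (v j - v i)) + ∑ i, ∑ j, S i j * (v j * (v i - v j))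
      = -∑ i, ∑ j, S i j * (v i - v j) ^ 2 := by
    simp only [← Finset.sum_add_distrib, ← Finset.sum_neg_distrib]
    exact Finset.sum_congr rfl fun i _ => Finset.sum_congr rfl fun j _ => by ring
  linarith

variable {N : ℕ} {p : ℝ} {q : Params N} {z : Fin N → ℝ}

theorem field_eq_of_field_eq_zero {i : Fin N} (hz : z i ≠ 0) (h0 : field p q z i = 0)
    (x : Fin N → ℝ) :
    field p q x i = ∑ j, q.2.1 i j * (x j - x i * z j / z i)
      + q.2.2 i * (z i ^ p - x i ^ p) * x i := by
  have h : field p q x i = field p q x i - x i / z i * field p q z i := by simp [h0]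
  rw [h]
  simp only [field, mul_add, Finset.mul_sum]
  have h1 : ∑ j, q.2.1 i j * (x j - x i * z j / z i)
      = ∑ j, q.2.1 i j * (x j - x i) - ∑ j, x i / z i * (q.2.1 i j * (z j - z i)) := by
    rw [← Finset.sum_sub_distrib]
    refine Finset.sum_congr rfl fun j _ => ?_
    field_simp
    ring
  rw [h1]
  field_simp
  ring

theorem sum_sub_mul_field (hsymm : ∀ i j, q.2.1 i j = q.2.1 j i)
    (hz : IsPositiveSteadyState p q z) (x : Fin N → ℝ) :
    ∑ i, (x i - z i) * field p q x i =
      -((1 / 2) * ∑ i, ∑ j, q.2.1 i j * z i * z j * ((x i - z i) / z i - (x j - z j) / z j) ^ 2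
        + ∑ i, q.2.2 i * ((x i ^ p - z i ^ p) * (x i - z i) * x i)) := by
  have hne : ∀ i, z i ≠ 0 := fun i => (hz.1 i).ne'
  have key := sum_symm_mul_sub (S := fun i j => q.2.1 i j * z i * z j)
    (fun i j => by simp only [hsymm i j]; ring) (fun i => (x i - z i) / z i)
  rw [neg_add, ← key, ← Finset.sum_neg_distrib, ← Finset.sum_add_distrib]
  refine Finset.sum_congr rfl fun i _ => ?_
  rw [field_eq_of_field_eq_zero (hne i) (hz.2 i), mul_add, Finset.mul_sum]
  congr 1
  · refine Finset.sum_congr rfl fun j _ => ?_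
    have := hne i
    have := hne j
    field_simp
    ring
  · ring

/-- If the form vanishes at `v`, then `v / z` is constant along edges and zero at stubborn agents,
hence zero everywhere by connectedness. Compactness of the sphere supplies the constant. -/
theorem exists_pos_mul_sum_sq_le (hq : q ∈ admissible N) (hz : z ∈ positiveOrthant N)
    {k : Fin N → ℝ} (hk : ∀ i, 0 < k i) :
    ∃ c : ℝ, 0 < c ∧ ∀ v : Fin N → ℝ, c * ∑ i, v i ^ 2 ≤
      (1 / 2) * ∑ i, ∑ j, q.2.1 i j * z i * z j * (v i / z i - v j / z j) ^ 2
        + ∑ i, q.2.2 i * (k i * v i ^ 2) := by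
  obtain ⟨-, -, hM, hσ, hconn⟩ := hq
  have hterm : ∀ (v : Fin N → ℝ) i j,
      0 ≤ q.2.1 i j * z i * z j * (v i / z i - v j / z j) ^ 2 := fun v i j =>
    mul_nonneg (mul_nonneg (mul_nonneg (hM i j) (hz i).le) (hz j).le) (sq_nonneg _)
  have hterm' : ∀ (v : Fin N → ℝ) i, 0 ≤ q.2.2 i * (k i * v i ^ 2) := fun v i =>
    mul_nonneg (hσ i) (mul_nonneg (hk i).le (sq_nonneg _))
  set Q : (Fin N → ℝ) → ℝ := fun v =>
    (1 / 2) * ∑ i, ∑ j, q.2.1 i j * z i * z j * (v i / z i - v j / z j) ^ 2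
      + ∑ i, q.2.2 i * (k i * v i ^ 2) with hQ
  have hcont : Continuous Q := by fun_prop
  have hhom : ∀ (s : ℝ) v, Q (s • v) = s ^ 2 * Q v := by
    intro s v
    simp only [hQ, Pi.smul_apply, smul_eq_mul, mul_add, Finset.mul_sum]
    congr 1
    · exact Finset.sum_congr rfl fun i _ => Finset.sum_congr rfl fun j _ => by ring
    · exact Finset.sum_congr rfl fun i _ => by ring
  have hpos : ∀ v, v ≠ 0 → 0 < Q v := by
    intro v hv
    have hA : 0 ≤ (1 / 2) * ∑ i, ∑ j, q.2.1 i j * z i * z j * (v i / z i - v j / z j) ^ 2 :=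
      mul_nonneg (by norm_num)
        (Finset.sum_nonneg fun i _ => Finset.sum_nonneg fun j _ => hterm v i j)
    have hB : 0 ≤ ∑ i, q.2.2 i * (k i * v i ^ 2) := Finset.sum_nonneg fun i _ => hterm' v i
    refine lt_of_le_of_ne (add_nonneg hA hB) fun h => hv ?_
    simp only [hQ] at h
    have hA0 : ∑ i, ∑ j, q.2.1 i j * z i * z j * (v i / z i - v j / z j) ^ 2 = 0 := by linarith
    have hB0 : ∑ i, q.2.2 i * (k i * v i ^ 2) = 0 := by linarith
    have hA1 : ∀ i j, 0 < q.2.1 i j → v i / z i = v j / z j := by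
      intro i j hij
      have h1 := (Finset.sum_eq_zero_iff_of_nonneg
        fun i _ => Finset.sum_nonneg fun j _ => hterm v i j).1 hA0 i (Finset.mem_univ i)
      have h2 := (Finset.sum_eq_zero_iff_of_nonneg fun j _ => hterm v i j).1 h1 j
        (Finset.mem_univ j)
      have h3 : 0 < q.2.1 i j * z i * z j := mul_pos (mul_pos hij (hz i)) (hz j)
      have h4 := (mul_eq_zero.1 h2).resolve_left h3.ne'
      exact sub_eq_zero.1 (pow_eq_zero_iff two_ne_zero |>.1 h4)
    have hB1 : ∀ i, 0 < q.2.2 i → v i = 0 := by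
      intro i hi
      have h1 := (Finset.sum_eq_zero_iff_of_nonneg fun i _ => hterm' v i).1 hB0 i
        (Finset.mem_univ i)
      have h2 := (mul_eq_zero.1 ((mul_eq_zero.1 h1).resolve_left hi.ne')).resolve_left (hk i).ne'
      exact pow_eq_zero_iff two_ne_zero |>.1 h2
    funext i
    obtain ⟨j, hij, hj⟩ := hconn i
    have h5 : v i / z i = v j / z j := by
      -- Intermediate vertices of the path need not be stubborn, so this must stay out of the
      -- induction hypothesis.
      clear hj
      induction hij with
      | refl => rfl
      | tail _ h ih => exact ih.trans (hA1 _ _ h)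
    rw [hB1 j hj, zero_div, div_eq_zero_iff] at h5
    exact h5.resolve_right (hz i).ne'
  obtain ⟨c, hc, hcv⟩ := exists_pos_mul_norm_sq_le hcont hhom hpos
  refine ⟨c / (N + 1), by positivity, fun v => (le_trans ?_ (hcv v))⟩
  rw [div_mul_eq_mul_div, div_le_iff₀ (by positivity)]
  nlinarith [mul_le_mul_of_nonneg_left (sum_sq_le_card_mul_norm_sq v) hc.le,
    mul_nonneg hc.le (sq_nonneg ‖v‖)]

/-- The squared Euclidean distance to a steady state is a strict Lyapunov function on the positive
orthant, uniformly on compact boxes. -/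
theorem exists_dissipation (hp : 0 < p) (hq : q ∈ admissible N)
    (hz : IsPositiveSteadyState p q z) {a b : Fin N → ℝ} (ha : ∀ i, 0 < a i) :
    ∃ c : ℝ, 0 < c ∧ ∀ x : Fin N → ℝ, (∀ i, a i ≤ x i) → (∀ i, x i ≤ b i) →
      ∑ i, (x i - z i) * field p q x i ≤ -(c * ∑ i, (x i - z i) ^ 2) := by
  choose k hk hkx using fun i =>
    exists_pos_mul_sq_le_rpow_sub (z := z i) (a := a i) (b := b i) hp (hz.1 i) (ha i)
  obtain ⟨c, hc, hcv⟩ := exists_pos_mul_sum_sq_le hq hz.1 hk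
  refine ⟨c, hc, fun x hax hxb => ?_⟩
  rw [sum_sub_mul_field hq.2.1 hz, neg_le_neg_iff]
  refine (hcv fun i => x i - z i).trans ?_
  exact add_le_add le_rfl (Finset.sum_le_sum fun i _ =>
    mul_le_mul_of_nonneg_left (hkx i (x i) (hax i) (hxb i)) (hq.2.2.2.1 i))

theorem IsPositiveSteadyState.eq (hp : 0 < p) (hq : q ∈ admissible N)
    (hz : IsPositiveSteadyState p q z) {y : Fin N → ℝ} (hy : IsPositiveSteadyState p q y) :
    y = z := by
  -- The box degenerates to the single point `y`.
  obtain ⟨c, hc, h⟩ := exists_dissipation (b := y) hp hq hz hy.1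
  have h1 := h y (fun _ => le_rfl) (fun _ => le_rfl)
  simp only [hy.2, mul_zero, Finset.sum_const_zero] at h1
  have h2 := norm_sq_le_sum_sq fun i => y i - z i
  have h3 : ‖fun i => y i - z i‖ ^ 2 ≤ 0 := by nlinarith
  have h4 : (fun i => y i - z i) = 0 := by
    rw [← norm_eq_zero]
    exact pow_eq_zero_iff two_ne_zero |>.1 (le_antisymm h3 (sq_nonneg _))
  funext i
  exact sub_eq_zero.1 (congrFun h4 i)

/-! ### Comparison with multiples of a steady state; Nash equilibria -/

theorem hasDerivAt_nonneg_of_le_right {φ : ℝ → ℝ} {d x : ℝ} (h : HasDerivAt φ d x)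
    (hmin : ∀ᶠ r in 𝓝[>] x, φ x ≤ φ r) : 0 ≤ d := by
  have h1 := (hasDerivWithinAt_iff_tendsto_slope' (self_notMem_Ioi)).1
    (h.hasDerivWithinAt (s := Ioi x))
  refine ge_of_tendsto h1 ?_
  filter_upwards [hmin, self_mem_nhdsWithin] with r hr hxr
  rw [slope_def_field]
  exact div_nonneg (sub_nonneg.2 hr) (sub_nonneg.2 (le_of_lt hxr))

theorem hasDerivAt_nonpos_of_le_left {φ : ℝ → ℝ} {d x : ℝ} (h : HasDerivAt φ d x)
    (hmin : ∀ᶠ r in 𝓝[<] x, φ x ≤ φ r) : d ≤ 0 := by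
  have h1 := (hasDerivWithinAt_iff_tendsto_slope' (self_notMem_Iio)).1
    (h.hasDerivWithinAt (s := Iio x))
  refine le_of_tendsto h1 ?_
  filter_upwards [hmin, self_mem_nhdsWithin] with r hr hxr
  rw [slope_def_field]
  exact div_nonpos_of_nonneg_of_nonpos (sub_nonneg.2 hr) (sub_nonpos.2 (le_of_lt hxr))

/-- Once `u` is eliminated, the coupling terms are `M i j * (y j - a * z j)`, and `y i ≤ z i` gives
the sign of the remaining term. -/
theorem field_nonneg_of_mul_le (hp : 0 < p) (hq : q ∈ admissible N)
    (hz : IsPositiveSteadyState p q z) {y : Fin N → ℝ} {i : Fin N} {a : ℝ} (ha : 0 < a)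
    (ha1 : a ≤ 1) (hi : y i = a * z i) (hle : ∀ j, a * z j ≤ y j) : 0 ≤ field p q y i := by
  have hzi := hz.1 i
  rw [field_eq_of_field_eq_zero hzi.ne' (hz.2 i)]
  have hyz : y i ≤ z i := by rw [hi]; exact mul_le_of_le_one_left hzi.le ha1
  have hy0 : 0 < y i := by rw [hi]; exact mul_pos ha hzi
  refine add_nonneg (Finset.sum_nonneg fun j _ => mul_nonneg (hq.2.2.1 i j) ?_)
    (mul_nonneg (mul_nonneg (hq.2.2.2.1 i) (sub_nonneg.2 ?_)) hy0.le)
  · rw [hi, sub_nonneg, div_le_iff₀ hzi]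
    nlinarith [mul_le_mul_of_nonneg_right (hle j) hzi.le]
  · exact Real.rpow_le_rpow hy0.le hyz hp.le

theorem field_nonpos_of_le_mul (hp : 0 < p) (hq : q ∈ admissible N)
    (hz : IsPositiveSteadyState p q z) {y : Fin N → ℝ} {i : Fin N} {a : ℝ}
    (ha1 : 1 ≤ a) (hi : y i = a * z i) (hle : ∀ j, y j ≤ a * z j) : field p q y i ≤ 0 := by
  have hzi := hz.1 i
  rw [field_eq_of_field_eq_zero hzi.ne' (hz.2 i)]
  have hyz : z i ≤ y i := by rw [hi]; exact le_mul_of_one_le_left hzi.le ha1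
  refine add_nonpos (Finset.sum_nonpos fun j _ =>
    mul_nonpos_of_nonneg_of_nonpos (hq.2.2.1 i j) ?_)
    (mul_nonpos_of_nonpos_of_nonneg (mul_nonpos_of_nonneg_of_nonpos (hq.2.2.2.1 i)
      (sub_nonpos.2 ?_)) (hzi.le.trans hyz))
  · rw [hi, sub_nonpos, le_div_iff₀ hzi]
    nlinarith [mul_le_mul_of_nonneg_right (hle j) hzi.le]
  · exact Real.rpow_le_rpow hzi.le hyz hp.le

theorem hasDerivAt_update_apply (x : Fin N → ℝ) (i j : Fin N) (r : ℝ) :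
    HasDerivAt (fun r => Function.update x i r j) ((Pi.single i 1 : Fin N → ℝ) j) r :=
  hasDerivAt_pi.1 (hasDerivAt_update x i r) j

theorem hasDerivAt_stubbornness_cost (hp : 0 < p) (s u : ℝ) {g : ℝ → ℝ} {g' r : ℝ}
    (hg : HasDerivAt g g' r) (hpos : 0 < g r) :
    HasDerivAt (fun r => s * (1 / (p + 2) * g r ^ (p + 2) - 1 / 2 * u * g r ^ 2))
      (-(s * (u - g r ^ p) * g r) * g') r := by
  have h1 := hg.rpow_const (p := p + 2) (Or.inl hpos.ne')
  have h2 := ((h1.const_mul (1 / (p + 2))).sub ((hg.pow 2).const_mul (1 / 2 * u))).const_mul s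
  refine h2.congr_deriv ?_
  have h3 : g r ^ (p + 2 - 1) = g r ^ p * g r := by
    rw [← Real.rpow_add_one hpos.ne']
    ring_nf
  rw [h3]
  have : p + 2 ≠ 0 := by positivity
  field_simp
  ring

theorem hasDerivAt_payout_update (hp : 0 < p) {x : Fin N → ℝ} {i : Fin N} {r : ℝ} (hr : 0 < r) :
    HasDerivAt (fun r => payout p q i (Function.update x i r))
      (-field p q (Function.update x i r) i) r := by
  have hu := fun j => hasDerivAt_update_apply x i j r
  have h1 : HasDerivAt (fun r => ∑ j, q.2.1 i j *
      (Function.update x i r i - Function.update x i r j) ^ 2) _ r :=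
    HasDerivAt.fun_sum fun j _ => (((hu i).sub (hu j)).pow 2).const_mul (q.2.1 i j)
  have h2 := hasDerivAt_stubbornness_cost hp (q.2.2 i) (q.1 i) (hu i) (by simpa using hr)
  refine ((h1.const_mul (1 / 2)).add h2).congr_deriv ?_
  simp only [field, neg_add, Pi.single_eq_same, mul_one, ← Finset.sum_neg_distrib, Finset.mul_sum]
  congr 1
  refine Finset.sum_congr rfl fun j _ => ?_
  rcases eq_or_ne j i with rfl | hj
  · simp
  · simp [hj]
    ring

theorem IsNashEquilibrium.isPositiveSteadyState (hp : 0 < p) {x : Fin N → ℝ}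
    (hx : IsNashEquilibrium p q x) : IsPositiveSteadyState p q x := by
  refine ⟨hx.1, fun i => ?_⟩
  have hd := hasDerivAt_payout_update (q := q) (x := x) (i := i) hp (hx.1 i)
  have hmin : IsLocalMin (fun r => payout p q i (Function.update x i r)) (x i) := by
    filter_upwards [Ioi_mem_nhds (hx.1 i)] with r hr
    simpa using hx.2 i r hr
  have h := hmin.hasDerivAt_eq_zero hd
  simpa using h

/-- The payout need not be convex in the agent's own strategy, but it decreases up to `x i` and
increases afterwards: changing coordinate `i` to `s` puts the point in the comparison situation with
factor `s / x i`. -/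
theorem IsPositiveSteadyState.isNashEquilibrium (hp : 0 < p) (hq : q ∈ admissible N)
    {x : Fin N → ℝ} (hx : IsPositiveSteadyState p q x) : IsNashEquilibrium p q x := by
  refine ⟨hx.1, fun i r hr => ?_⟩
  have hxi := hx.1 i
  have hd : ∀ s, 0 < s → HasDerivAt (fun r => payout p q i (Function.update x i r))
      (-field p q (Function.update x i s) i) s := fun s hs => hasDerivAt_payout_update hp hs
  suffices h : (fun r => payout p q i (Function.update x i r)) (x i)
      ≤ (fun r => payout p q i (Function.update x i r)) r by simpa using h
  rcases le_total r (x i) with h | h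
  · have hanti : AntitoneOn (fun r => payout p q i (Function.update x i r)) (Icc r (x i)) := by
      refine antitoneOn_of_hasDerivWithinAt_nonpos (convex_Icc _ _)
        (fun s hs => (hd s (hr.trans_le hs.1)).continuousAt.continuousWithinAt)
        (fun s hs => (hd s (hr.trans_le (interior_subset hs).1)).hasDerivWithinAt) fun s hs => ?_
      have hs' := interior_subset hs
      rw [neg_nonpos]
      have hs1 : s / x i ≤ 1 := (div_le_one hxi).2 hs'.2
      refine field_nonneg_of_mul_le hp hq hx (a := s / x i) (div_pos (hr.trans_le hs'.1) hxi)
        hs1 (by simp [hxi.ne']) fun j => ?_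
      rcases eq_or_ne j i with rfl | hj
      · simp [hxi.ne']
      · simpa [hj] using mul_le_of_le_one_left (hx.1 j).le hs1
    exact hanti ⟨le_rfl, h⟩ ⟨h, le_rfl⟩ h
  · have hmono : MonotoneOn (fun r => payout p q i (Function.update x i r)) (Icc (x i) r) := by
      refine monotoneOn_of_hasDerivWithinAt_nonneg (convex_Icc _ _)
        (fun s hs => (hd s (hxi.trans_le hs.1)).continuousAt.continuousWithinAt)
        (fun s hs => (hd s (hxi.trans_le (interior_subset hs).1)).hasDerivWithinAt) fun s hs => ?_
      have hs' := interior_subset hs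
      rw [neg_nonneg]
      have hs1 : 1 ≤ s / x i := (one_le_div hxi).2 hs'.1
      refine field_nonpos_of_le_mul hp hq hx (a := s / x i) hs1 (by simp [hxi.ne']) fun j => ?_
      rcases eq_or_ne j i with rfl | hj
      · simp [hxi.ne']
      · simpa [hj] using le_mul_of_one_le_left (hx.1 j).le hs1
    exact hmono ⟨le_rfl, h⟩ ⟨h, le_rfl⟩ h

/-! ### Existence by minimizing a potential -/

/-- The potential whose negative gradient is `field p q` when the coupling is symmetric. -/
noncomputable def potential (p : ℝ) (q : Params N) (x : Fin N → ℝ) : ℝ :=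
  (1 / 4) * ∑ i, ∑ j, q.2.1 i j * (x i - x j) ^ 2
    + ∑ i, q.2.2 i * (1 / (p + 2) * x i ^ (p + 2) - (1 / 2) * q.1 i * x i ^ 2)

theorem continuous_potential (hp : 0 < p) : Continuous (potential p q) := by
  have h : Continuous fun r : ℝ => r ^ (p + 2) := Real.continuous_rpow_const (by positivity)
  have h' : ∀ i : Fin N, Continuous fun x : Fin N → ℝ => x i ^ (p + 2) :=
    fun i => h.comp (continuous_apply i)
  unfold potential
  fun_prop

theorem hasDerivAt_potential_update (hp : 0 < p) (hsymm : ∀ i j, q.2.1 i j = q.2.1 j i)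
    {x : Fin N → ℝ} (hx : x ∈ positiveOrthant N) (i : Fin N) :
    HasDerivAt (fun r => potential p q (Function.update x i r)) (-field p q x i) (x i) := by
  have hu := fun j => hasDerivAt_update_apply x i j (x i)
  have h1 : HasDerivAt (fun r => ∑ k, ∑ j, q.2.1 k j *
      (Function.update x i r k - Function.update x i r j) ^ 2) _ (x i) :=
    HasDerivAt.fun_sum fun k _ => HasDerivAt.fun_sum fun j _ =>
      (((hu k).fun_sub (hu j)).fun_pow 2).const_mul (q.2.1 k j)
  have h2 : HasDerivAt (fun r => ∑ k, q.2.2 k * (1 / (p + 2) * Function.update x i r k ^ (p + 2)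
      - 1 / 2 * q.1 k * Function.update x i r k ^ 2)) _ (x i) :=
    HasDerivAt.fun_sum fun k _ => hasDerivAt_stubbornness_cost hp (q.2.2 k) (q.1 k) (hu k)
      (by simpa using hx k)
  refine ((h1.const_mul (1 / 4)).add h2).congr_deriv ?_
  set δ : Fin N → ℝ := Pi.single i 1 with hδ
  have hδi : ∀ c : Fin N → ℝ, ∑ k, c k * δ k = c i := by
    intro c
    simp [hδ, Pi.single_apply]
  simp only [Function.update_eq_self, field, neg_add]
  rw [hδi fun k => -(q.2.2 k * (q.1 k - x k ^ p) * x k)]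
  congr 1
  -- Symmetry of `M` makes the column contribution equal to the row contribution, which is why the
  -- potential carries `1 / 4` where the payout has `1 / 2`.
  have h3 : ∑ k, ∑ j, q.2.1 k j * (x k - x j) * δ j = -∑ k, ∑ j, q.2.1 k j * (x k - x j) * δ k := by
    rw [Finset.sum_comm, ← Finset.sum_neg_distrib]
    refine Finset.sum_congr rfl fun k _ => ?_
    rw [← Finset.sum_neg_distrib]
    refine Finset.sum_congr rfl fun j _ => ?_
    rw [hsymm j k]
    ring
  have h4 : ∑ k, ∑ j, q.2.1 k j * (x k - x j) * δ k = ∑ j, q.2.1 i j * (x i - x j) := by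
    simp only [← Finset.sum_mul]
    exact hδi fun k => ∑ j, q.2.1 k j * (x k - x j)
  have h5 : ∑ k, ∑ j, q.2.1 k j * ((2 : ℕ) * (x k - x j) ^ (2 - 1) * (δ k - δ j))
      = 2 * ∑ k, ∑ j, q.2.1 k j * (x k - x j) * δ k
        - 2 * ∑ k, ∑ j, q.2.1 k j * (x k - x j) * δ j := by
    simp only [Finset.mul_sum, ← Finset.sum_sub_distrib]
    refine Finset.sum_congr rfl fun k _ => Finset.sum_congr rfl fun j _ => ?_
    push_cast
    ring
  rw [h3, h4] at h5
  have h6 : ∑ j, q.2.1 i j * (x j - x i) = -∑ j, q.2.1 i j * (x i - x j) := by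
    rw [← Finset.sum_neg_distrib]
    exact Finset.sum_congr rfl fun j _ => by ring
  rw [h6]
  refine (congrArg (1 / 4 * ·) h5).trans ?_
  ring

/-- A minimizer over a cube `[ε, R]^N` with `ε ^ p ≤ u i ≤ R ^ p` works even on the boundary. Each
sign of the field comes from a one-sided variation when there is room to move, and otherwise
directly from the choice of `ε` or `R`. -/
theorem exists_isPositiveSteadyState (hp : 0 < p) (hq : q ∈ admissible N) :
    ∃ x, IsPositiveSteadyState p q x := by
  obtain ⟨hu, hsymm, hM, hσ, -⟩ := hq
  obtain ⟨ε, hε, hεu⟩ : ∃ ε : ℝ, 0 < ε ∧ ∀ i, ε ^ p ≤ q.1 i := by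
    rcases isEmpty_or_nonempty (Fin N) with h | h
    · exact ⟨1, one_pos, fun i => h.elim i⟩
    · obtain ⟨k, hk⟩ := Finite.exists_min q.1
      refine ⟨q.1 k ^ p⁻¹, Real.rpow_pos_of_pos (hu k) _, fun i => ?_⟩
      rw [Real.rpow_inv_rpow (hu k).le hp.ne']
      exact hk i
  obtain ⟨R, hεR, hRu⟩ : ∃ R : ℝ, ε ≤ R ∧ ∀ i, q.1 i ≤ R ^ p := by
    rcases isEmpty_or_nonempty (Fin N) with h | h
    · exact ⟨ε, le_rfl, fun i => h.elim i⟩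
    · obtain ⟨k, hk⟩ := Finite.exists_max q.1
      refine ⟨q.1 k ^ p⁻¹, ?_, fun i => ?_⟩
      · rw [Real.le_rpow_inv_iff_of_pos hε.le (hu k).le hp]
        exact hεu k
      · rw [Real.rpow_inv_rpow (hu k).le hp.ne']
        exact hk i
  obtain ⟨x, hx, hmin⟩ := (isCompact_Icc (a := fun _ : Fin N => ε) (b := fun _ => R)).exists_isMinOn
    (nonempty_Icc.2 fun _ => hεR) (continuous_potential (q := q) hp).continuousOn
  have hxpos : x ∈ positiveOrthant N := fun i => hε.trans_le (hx.1 i)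
  have hval : ∀ i r, ε ≤ r → r ≤ R → potential p q (Function.update x i (x i))
      ≤ potential p q (Function.update x i r) := by
    intro i r h1 h2
    rw [Function.update_eq_self]
    refine hmin ⟨fun j => ?_, fun j => ?_⟩
    · rcases eq_or_ne j i with rfl | hj
      · simpa using h1
      · simpa [hj] using hx.1 j
    · rcases eq_or_ne j i with rfl | hj
      · simpa using h2
      · simpa [hj] using hx.2 j
  refine ⟨x, hxpos, fun i => le_antisymm ?_ ?_⟩
  · rcases (hx.2 i).lt_or_eq with h | h
    · refine neg_nonneg.1 (hasDerivAt_nonneg_of_le_right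
        (hasDerivAt_potential_update hp hsymm hxpos i) ?_)
      filter_upwards [Ioo_mem_nhdsGT h] with r hr
      exact hval i r ((hx.1 i).trans hr.1.le) hr.2.le
    · have h1 : x i = R := h
      refine add_nonpos (Finset.sum_nonpos fun j _ => mul_nonpos_of_nonneg_of_nonpos (hM i j) ?_)
        (mul_nonpos_of_nonpos_of_nonneg (mul_nonpos_of_nonneg_of_nonpos (hσ i) ?_) (hxpos i).le)
      · rw [h1]
        exact sub_nonpos.2 (hx.2 j)
      · rw [h1]
        exact sub_nonpos.2 (hRu i)
  · rcases (hx.1 i).lt_or_eq with h | h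
    · refine neg_nonpos.1 (hasDerivAt_nonpos_of_le_left
        (hasDerivAt_potential_update hp hsymm hxpos i) ?_)
      filter_upwards [Ioo_mem_nhdsLT h] with r hr
      exact hval i r hr.1.le (hr.2.le.trans (hx.2 i))
    · have h1 : x i = ε := h.symm
      refine add_nonneg (Finset.sum_nonneg fun j _ => mul_nonneg (hM i j) ?_)
        (mul_nonneg (mul_nonneg (hσ i) ?_) (hxpos i).le)
      · rw [h1]
        exact sub_nonneg.2 (hx.1 j)
      · rw [h1]
        exact sub_nonneg.2 (hεu i)

/-! ### Smooth dependence on the parameters -/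

/-- The requirement on the value at a point is convex (a singleton on `A`, no constraint off `A`),
so a partition of unity on the open manifold `U` averages the local extensions. -/
theorem exists_contDiffOn_extension {E F : Type*} [NormedAddCommGroup E] [NormedSpace ℝ E]
    [FiniteDimensional ℝ E] [NormedAddCommGroup F] [NormedSpace ℝ F] (A : Set E) (f : E → F)
    (h : ∀ x ∈ A, ∃ V ∈ 𝓝 x, ∃ g : E → F, ContDiffOn ℝ ∞ g V ∧ ∀ y ∈ V, y ∈ A → g y = f y) :
    ∃ (U : Set E) (G : E → F), IsOpen U ∧ A ⊆ U ∧ ContDiffOn ℝ ∞ G U ∧ ∀ x ∈ A, G x = f x := by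
  classical
  choose! V hV g hg hgf using h
  let U : TopologicalSpace.Opens E := ⟨⋃ x ∈ A, interior (V x),
    isOpen_biUnion fun x _ => isOpen_interior⟩
  have hAU : A ⊆ U := fun x hx => mem_biUnion hx (mem_interior_iff_mem_nhds.2 (hV x hx))
  have : ProperSpace E := FiniteDimensional.proper ℝ E
  have : LocallyCompactSpace U := U.isOpen.locallyCompactSpace
  obtain ⟨G, hG⟩ := exists_contMDiffMap_forall_mem_convex_of_local (n := (⊤ : ℕ∞))
    (modelWithCornersSelf ℝ E) (M := U) (F := F) (t := fun x => {y | (x : E) ∈ A → y = f x})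
    (fun x => by
      by_cases hx : (x : E) ∈ A
      · simp [hx]
      · simp [hx, convex_univ])
    (fun x => by
      obtain ⟨x₀, hx₀, hx⟩ := mem_iUnion₂.1 x.2
      refine ⟨Subtype.val ⁻¹' interior (V x₀),
        (isOpen_interior.preimage continuous_subtype_val).mem_nhds hx, g x₀ ∘ Subtype.val, ?_,
        fun y hy hyA => hgf x₀ hx₀ y (interior_subset hy) hyA⟩
      exact ((hg x₀ hx₀).mono interior_subset).contMDiffOn.comp
        contMDiff_subtype_val.contMDiffOn fun y hy => hy)
  refine ⟨U, fun x => if hx : x ∈ U then G ⟨x, hx⟩ else 0, U.isOpen, hAU, ?_, fun x hx => ?_⟩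
  · intro x hx
    refine ContDiffAt.contDiffWithinAt ?_
    rw [← contMDiffAt_iff_contDiffAt]
    have h1 := contMDiffAt_subtype_iff (I := modelWithCornersSelf ℝ E)
      (I' := modelWithCornersSelf ℝ F) (n := ∞) (U := U) (x := ⟨x, hx⟩)
      (f := fun x => if hx : x ∈ U then G ⟨x, hx⟩ else 0)
    refine h1.1 (G.contMDiff.contMDiffAt.congr_of_eventuallyEq (Eventually.of_forall fun y => ?_))
    simp
  · have hx' : x ∈ U := hAU hx
    simp only [hx', dite_true]
    exact hG ⟨x, hx'⟩ hx

theorem contDiffAt_uncurry_field (n : WithTop ℕ∞) (hz : z ∈ positiveOrthant N) :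
    ContDiffAt ℝ n (fun w : Params N × (Fin N → ℝ) => field p w.1 w.2) (q, z) := by
  refine contDiffAt_pi.2 fun i => ?_
  have hx : ∀ j, ContDiffAt ℝ n (fun w : Params N × (Fin N → ℝ) => w.2 j) (q, z) :=
    fun j => by fun_prop
  have hM : ∀ j, ContDiffAt ℝ n (fun w : Params N × (Fin N → ℝ) => w.1.2.1 i j) (q, z) :=
    fun j => by fun_prop
  have hu : ContDiffAt ℝ n (fun w : Params N × (Fin N → ℝ) => w.1.1 i) (q, z) := by fun_prop
  have hs : ContDiffAt ℝ n (fun w : Params N × (Fin N → ℝ) => w.1.2.2 i) (q, z) := by fun_prop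
  exact (ContDiffAt.sum fun j _ => (hM j).mul ((hx j).sub (hx i))).add
    ((hs.mul (hu.sub ((hx i).rpow_const_of_ne (hz i).ne'))).mul (hx i))

/-- The linearization at a positive steady state has trivial kernel. -/
theorem injective_of_hasFDerivAt_field (hp : 0 < p) (hq : q ∈ admissible N)
    (hz : IsPositiveSteadyState p q z) {A : (Fin N → ℝ) →L[ℝ] (Fin N → ℝ)}
    (hA : HasFDerivAt (field p q) A z) : Function.Injective A := by
  rw [injective_iff_map_eq_zero]
  intro h hAh
  obtain ⟨c, hc, hdiss⟩ := exists_dissipation (a := fun i => z i / 2) (b := fun i => z i + 1)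
    hp hq hz fun i => half_pos (hz.1 i)
  have hline : HasDerivAt (fun t : ℝ => z + t • h) h 0 := by
    simpa using ((hasDerivAt_id (0 : ℝ)).smul_const h).const_add z
  have hA' : HasFDerivAt (field p q) A (z + (0 : ℝ) • h) := by simpa using hA
  have h1 := hasDerivAt_pi.1 (hA'.comp_hasDerivAt (0 : ℝ) hline)
  -- By dissipation this function is nonnegative for small `t > 0`, and it vanishes at `0`. Its
  -- derivative there is `-c * ∑ i, h i ^ 2` when `A h = 0`, which forces `h = 0`.
  have h2 : HasDerivAt (fun t : ℝ => -∑ i, h i * field p q (z + t • h) i - c * t * ∑ i, h i ^ 2)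
      (-∑ i, h i * A h i - c * 1 * ∑ i, h i ^ 2) 0 :=
    (HasDerivAt.fun_sum fun i _ => (h1 i).const_mul (h i)).fun_neg.fun_sub
      (((hasDerivAt_id (0 : ℝ)).const_mul c).mul_const _)
  have h3 := hasDerivAt_nonneg_of_le_right h2 ?_
  · simp only [hAh, Pi.zero_apply, mul_zero, Finset.sum_const_zero, neg_zero, mul_one] at h3
    have h4 : ‖h‖ ^ 2 ≤ 0 := by nlinarith [norm_sq_le_sum_sq h]
    rw [← norm_eq_zero]
    exact pow_eq_zero_iff two_ne_zero |>.1 (le_antisymm h4 (sq_nonneg _))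
  · have hbox : ∀ᶠ t : ℝ in 𝓝[>] 0, ∀ i, z i / 2 ≤ (z + t • h) i ∧ (z + t • h) i ≤ z i + 1 := by
      refine eventually_all.2 fun i => ?_
      have hcont := (hasDerivAt_pi.1 hline i).continuousAt
      have hmem : Icc (z i / 2) (z i + 1) ∈ 𝓝 ((z + (0 : ℝ) • h) i) := by
        have := hz.1 i
        exact Icc_mem_nhds (by simpa using half_lt_self this) (by simp)
      exact (hcont.eventually hmem).filter_mono nhdsWithin_le_nhds
    filter_upwards [hbox, self_mem_nhdsWithin] with t ht ht0
    have ht0' : 0 < t := ht0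
    have h5 := hdiss (z + t • h) (fun i => (ht i).1) (fun i => (ht i).2)
    have h6 : ∑ i, ((z + t • h) i - z i) * field p q (z + t • h) i
        = t * ∑ i, h i * field p q (z + t • h) i := by
      rw [Finset.mul_sum]
      exact Finset.sum_congr rfl fun i _ => by simp; ring
    have h7 : ∑ i, ((z + t • h) i - z i) ^ 2 = t * (t * ∑ i, h i ^ 2) := by
      rw [Finset.mul_sum, Finset.mul_sum]
      exact Finset.sum_congr rfl fun i _ => by simp; ring
    rw [h6, h7] at h5
    have h8 : ∑ i, h i * field p q (z + t • h) i ≤ -(c * (t * ∑ i, h i ^ 2)) := by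
      refine le_of_mul_le_mul_left ?_ ht0'
      linarith
    simp only [zero_smul, add_zero, hz.2, mul_zero, Finset.sum_const_zero, neg_zero, zero_mul,
      sub_zero]
    linarith

theorem exists_local_smooth_steadyState (hp : 0 < p) (hq : q ∈ admissible N) :
    ∃ V ∈ 𝓝 q, ∃ g : Params N → (Fin N → ℝ), ContDiffOn ℝ ∞ g V ∧
      ∀ q' ∈ V, IsPositiveSteadyState p q' (g q') := by
  obtain ⟨z, hz⟩ := exists_isPositiveSteadyState hp hq
  set F : Params N × (Fin N → ℝ) → (Fin N → ℝ) := fun w => field p w.1 w.2 with hF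
  -- Order `ω` rather than `∞`: analyticity at a point persists on a neighbourhood, whereas
  -- `ContDiffAt ℝ ∞` need not.
  have hFsmooth : ContDiffAt ℝ ω F (q, z) := contDiffAt_uncurry_field ω hz.1
  have hω : (ω : WithTop ℕ∞) ≠ 0 := by simp
  have hderiv : HasFDerivAt (field p q) (fderiv ℝ F (q, z) ∘L .inr ℝ (Params N) (Fin N → ℝ)) z :=
    (hFsmooth.differentiableAt hω).hasFDerivAt.comp z (hasFDerivAt_prodMk_right q z)
  have hinj := injective_of_hasFDerivAt_field hp hq hz hderiv
  have hinv : (fderiv ℝ F (q, z) ∘L .inr ℝ (Params N) (Fin N → ℝ)).IsInvertible :=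
    ⟨(LinearEquiv.ofInjectiveEndo _ hinj).toContinuousLinearEquiv, by ext; rfl⟩
  set ψ := hFsmooth.implicitFunction hω hinv with hψ
  have hψ0 : ψ q = z := hFsmooth.implicitFunction_apply_self hω hinv
  have hψs : ContDiffAt ℝ ω ψ q := hFsmooth.contDiffAt_implicitFunction hω hinv
  have hzero : F (q, z) = 0 := funext hz.2
  have hev : ∀ᶠ q' in 𝓝 q, field p q' (ψ q') = 0 := by
    have h := hFsmooth.eventually_apply_implicitFunction hω hinv
    rw [hzero] at h
    exact h
  have hposev : ∀ᶠ q' in 𝓝 q, ∀ i, 0 < ψ q' i := by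
    refine eventually_all.2 fun i => ?_
    have hcont : ContinuousAt (fun q' => ψ q' i) q :=
      (continuous_apply i).continuousAt.comp hψs.continuousAt
    exact hcont.eventually (Ioi_mem_nhds (by simpa [hψ0] using hz.1 i))
  refine ⟨{q' | ContDiffAt ℝ ω ψ q' ∧ field p q' (ψ q') = 0 ∧ ∀ i, 0 < ψ q' i},
    (hψs.eventually (by simp)).and (hev.and hposev), ψ,
    fun q' hq' => (hq'.1.of_le le_top).contDiffWithinAt, fun q' hq' =>
      ⟨hq'.2.2, congrFun hq'.2.1⟩⟩

theorem exists_smooth_steadyState (N : ℕ) (hp : 0 < p) :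
    ∃ (U : Set (Params N)) (X : Params N → (Fin N → ℝ)), IsOpen U ∧ admissible N ⊆ U ∧
      ContDiffOn ℝ ∞ X U ∧ ∀ q ∈ admissible N, IsPositiveSteadyState p q (X q) := by
  choose! f hf using fun (q : Params N) (hq : q ∈ admissible N) =>
    exists_isPositiveSteadyState hp hq
  obtain ⟨U, X, hU, hAU, hX, hXf⟩ := exists_contDiffOn_extension (admissible N) f fun q hq => by
    obtain ⟨V, hV, g, hg, hgs⟩ := exists_local_smooth_steadyState hp hq
    exact ⟨V, hV, g, hg, fun y hy hyA => (hf y hyA).eq hp hyA (hgs y hy)⟩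
  exact ⟨U, X, hU, hAU, hX, fun q hq => by rw [hXf q hq]; exact hf q hq⟩

/-! ### Global solutions and invariant boxes -/

theorem hasDerivAt_rpow_mul_self {p : ℝ} (hp : 0 < p) (x : ℝ) :
    HasDerivAt (fun x : ℝ => x ^ p * x) ((p + 1) * x ^ p) x := by
  rcases eq_or_ne x 0 with rfl | hx
  · rw [hasDerivAt_iff_tendsto_slope]
    have h1 : Tendsto (fun x : ℝ => x ^ p) (𝓝[≠] 0) (𝓝 ((p + 1) * 0 ^ p)) := by
      have h2 := (Real.continuous_rpow_const hp.le).tendsto 0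
      simp only [Real.zero_rpow hp.ne', mul_zero] at h2 ⊢
      exact h2.mono_left nhdsWithin_le_nhds
    refine h1.congr' ?_
    filter_upwards [self_mem_nhdsWithin] with y hy
    have hy' : y ≠ 0 := hy
    simp [slope_def_field, hy']
  · refine ((Real.hasDerivAt_rpow_const (Or.inl hx)).mul (hasDerivAt_id x)).congr_deriv ?_
    have h : x ^ (p - 1) * x = x ^ p := by
      rw [Real.rpow_sub_one hx, div_mul_cancel₀ _ hx]
    simp only [id, mul_one]
    linear_combination p * h

/-- This makes the field `C^1` on the whole space, so uniqueness applies to solutions not yet known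
to stay positive. -/
theorem contDiff_rpow_mul_self {p : ℝ} (hp : 0 < p) :
    ContDiff ℝ 1 fun x : ℝ => x ^ p * x := by
  refine contDiff_one_iff_deriv.2
    ⟨fun x => (hasDerivAt_rpow_mul_self hp x).differentiableAt, ?_⟩
  rw [funext fun x => (hasDerivAt_rpow_mul_self hp x).deriv]
  exact continuous_const.mul (Real.continuous_rpow_const hp.le)

/-- After the last time with `y ≥ α`, the function would lie below `α` and still be nondecreasing.
-/
theorem le_of_forall_lt_deriv_nonneg {y y' : ℝ → ℝ} {α : ℝ}
    (hy : ∀ t, 0 ≤ t → HasDerivWithinAt y (y' t) (Ici 0) t) (h0 : α ≤ y 0)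
    (hy' : ∀ t, 0 ≤ t → y t < α → 0 ≤ y' t) {t : ℝ} (ht : 0 ≤ t) : α ≤ y t := by
  by_contra! hlt
  have hcont : ContinuousOn y (Icc 0 t) := fun s hs =>
    (hy s hs.1).continuousWithinAt.mono Icc_subset_Ici_self
  have hcomp : IsCompact (Icc 0 t ∩ y ⁻¹' Ici α) :=
    isCompact_Icc.of_isClosed_subset (hcont.preimage_isClosed_of_isClosed isClosed_Icc isClosed_Ici)
      inter_subset_left
  obtain ⟨s, ⟨hs, hsα⟩, hmax⟩ := hcomp.exists_isGreatest ⟨0, ⟨le_rfl, ht⟩, h0⟩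
  have hmono : MonotoneOn y (Icc s t) := by
    refine monotoneOn_of_hasDerivWithinAt_nonneg (f' := y') (convex_Icc _ _)
      (hcont.mono (Icc_subset_Icc_left hs.1)) (fun r hr => ?_) (fun r hr => ?_)
    · rw [interior_Icc] at hr ⊢
      exact (hy r (hs.1.trans hr.1.le)).mono fun x hx => hs.1.trans hx.1.le
    · rw [interior_Icc] at hr
      refine hy' r (hs.1.trans hr.1.le) ?_
      by_contra! hge
      exact absurd (hmax ⟨⟨hs.1.trans hr.1.le, hr.2.le⟩, hge⟩) (not_le.2 hr.1)
  exact absurd (hmono ⟨le_rfl, hs.2⟩ ⟨hs.2, le_rfl⟩ hs.2) (not_le.2 (hlt.trans_le hsα))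

theorem exists_forall_hasDerivWithinAt_Ici {E : Type*} [NormedAddCommGroup E] [NormedSpace ℝ E]
    [CompleteSpace E] {f : E → E} {K L : NNReal} (hf : LipschitzWith K f) (hL : ∀ x, ‖f x‖ ≤ L)
    (x₀ : E) :
    ∃ x : ℝ → E, x 0 = x₀ ∧ ∀ t, 0 ≤ t → HasDerivWithinAt x (f (x t)) (Ici 0) t := by
  have hloc : ∀ n : ℕ, ∃ y : ℝ → E, y 0 = x₀ ∧
      ∀ t ∈ Icc (0 : ℝ) (n + 1), HasDerivWithinAt y (f (y t)) (Icc 0 (n + 1)) t := by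
    intro n
    have hn : (0 : ℝ) ≤ n + 1 := by positivity
    have hpl : IsPicardLindelof (fun _ => f) (tmin := 0) (tmax := n + 1) ⟨0, le_rfl, hn⟩ x₀
        (L * (n + 1)) 0 L K :=
      { lipschitzOnWith := fun _ _ => hf.lipschitzOnWith
        continuousOn := fun _ _ => continuousOn_const
        norm_le := fun _ _ x _ => hL x
        mul_max_le := by simp [max_eq_left hn] }
    exact hpl.exists_eq_forall_mem_Icc_hasDerivWithinAt₀
  choose y hy0 hy using hloc
  have hcont : ∀ n : ℕ, ContinuousOn (y n) (Icc 0 (n + 1)) := fun n t ht =>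
    (hy n t ht).continuousWithinAt
  have hright : ∀ (m n : ℕ), m ≤ n → ∀ t ∈ Ico (0 : ℝ) (m + 1),
      HasDerivWithinAt (y n) (f (y n t)) (Ici t) t := by
    intro m n hmn t ht
    have hlt : t < (n : ℝ) + 1 := ht.2.trans_le (by gcongr)
    refine (hy n t ⟨ht.1, hlt.le⟩).mono_of_mem_nhdsWithin ?_
    exact mem_of_superset (Icc_mem_nhdsGE hlt) (Icc_subset_Icc_left ht.1)
  have heq : ∀ m n : ℕ, m ≤ n → EqOn (y m) (y n) (Icc 0 (m + 1)) := by
    intro m n hmn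
    exact ODE_solution_unique (v := fun _ => f) (fun _ => hf) (hcont m) (hright m m le_rfl)
      ((hcont n).mono (Icc_subset_Icc_right (by gcongr))) (hright m n hmn)
      ((hy0 m).trans (hy0 n).symm)
  have hx : ∀ n : ℕ, ∀ t : ℝ, 0 ≤ t → t < n + 1 → y ⌊t⌋₊ t = y n t := by
    intro n t ht htn
    have hfl : ⌊t⌋₊ ≤ n := by
      rw [← Nat.lt_add_one_iff, Nat.floor_lt ht]
      exact_mod_cast htn
    exact heq _ _ hfl ⟨ht, (Nat.lt_floor_add_one t).le⟩
  -- The `n`-th solution lives up to `n + 1`, so `t` is never the right end of the interval chosen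
  -- by `⌊t⌋₊`.
  refine ⟨fun t => y ⌊t⌋₊ t, by simp [hy0], fun t ht => ?_⟩
  have htn : t < (⌊t⌋₊ : ℝ) + 1 := Nat.lt_floor_add_one t
  have hd : HasDerivWithinAt (y ⌊t⌋₊) (f (y ⌊t⌋₊ t)) (Ici 0) t := by
    refine (hy ⌊t⌋₊ t ⟨ht, htn.le⟩).mono_of_mem_nhdsWithin ?_
    filter_upwards [self_mem_nhdsWithin, nhdsWithin_le_nhds (Iic_mem_nhds htn)] with s h1 h2
    exact ⟨h1, h2⟩
  refine hd.congr_of_eventuallyEq ?_ rfl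
  filter_upwards [self_mem_nhdsWithin, nhdsWithin_le_nhds (Iio_mem_nhds htn)] with s h1 h2
  exact hx _ s h1 h2

theorem eq_of_hasDerivWithinAt_Ici {E : Type*} [NormedAddCommGroup E] [NormedSpace ℝ E]
    {f : E → E} (hf : LocallyLipschitz f) {x y : ℝ → E}
    (hx : ∀ t, 0 ≤ t → HasDerivWithinAt x (f (x t)) (Ici 0) t)
    (hy : ∀ t, 0 ≤ t → HasDerivWithinAt y (f (y t)) (Ici 0) t) (h0 : x 0 = y 0) {t : ℝ}
    (ht : 0 ≤ t) : x t = y t := by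
  have hxc : ContinuousOn x (Icc 0 t) := fun s hs =>
    (hx s hs.1).continuousWithinAt.mono Icc_subset_Ici_self
  have hyc : ContinuousOn y (Icc 0 t) := fun s hs =>
    (hy s hs.1).continuousWithinAt.mono Icc_subset_Ici_self
  obtain ⟨K, hK⟩ := (hf.locallyLipschitzOn
    (s := x '' Icc 0 t ∪ y '' Icc 0 t)).exists_lipschitzOnWith_of_compact
    ((isCompact_Icc.image_of_continuousOn hxc).union (isCompact_Icc.image_of_continuousOn hyc))
  exact ODE_solution_unique_of_mem_Icc_right (v := fun _ => f) (fun _ _ => hK) hxc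
    (fun s hs => (hx s hs.1).mono (Ici_subset_Ici.2 hs.1))
    (fun s hs => Or.inl (mem_image_of_mem x (Ico_subset_Icc_self hs))) hyc
    (fun s hs => (hy s hs.1).mono (Ici_subset_Ici.2 hs.1))
    (fun s hs => Or.inr (mem_image_of_mem y (Ico_subset_Icc_self hs))) h0 ⟨ht, le_rfl⟩

theorem contDiff_field (hp : 0 < p) : ContDiff ℝ 1 (field p q) := by
  refine contDiff_pi.2 fun i => ?_
  have h : ContDiff ℝ 1 fun x : Fin N → ℝ => x i ^ p * x i :=
    (contDiff_rpow_mul_self hp).comp (contDiff_apply ℝ ℝ i)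
  have h2 : (fun x : Fin N → ℝ => field p q x i) = fun x =>
      ∑ j, q.2.1 i j * (x j - x i) + q.2.2 i * (q.1 i * x i - x i ^ p * x i) := by
    funext x
    simp only [field]
    ring
  rw [h2]
  fun_prop

/-- Coordinatewise projection onto the box `Icc l h`. -/
def boxClamp (l h x : Fin N → ℝ) : Fin N → ℝ := fun i => max (l i) (min (h i) (x i))

theorem boxClamp_mem {l h : Fin N → ℝ} (hlh : l ≤ h) (x : Fin N → ℝ) :
    boxClamp l h x ∈ Icc l h :=
  ⟨fun _ => le_max_left _ _, fun i => max_le (hlh i) (min_le_left _ _)⟩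

theorem boxClamp_of_mem {l h x : Fin N → ℝ} (hx : x ∈ Icc l h) : boxClamp l h x = x :=
  funext fun i => by simp [boxClamp, hx.1 i, hx.2 i]

theorem lipschitzWith_boxClamp (l h : Fin N → ℝ) : LipschitzWith 1 (boxClamp l h) := by
  refine LipschitzWith.of_dist_le_mul fun x y => ?_
  rw [NNReal.coe_one, one_mul]
  refine (dist_pi_le_iff dist_nonneg).2 fun i => ?_
  have h1 : LipschitzWith 1 fun r : ℝ => max (l i) (min (h i) r) :=
    (LipschitzWith.id.const_min (h i)).const_max (l i)
  exact (h1.dist_le_mul (x i) (y i)).trans (by simpa using dist_le_pi_dist x y i)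

/-- Boxes spanned by a multiple below and a multiple above a steady state are positively
invariant. -/
theorem exists_isSolution_mem_box (hp : 0 < p) (hq : q ∈ admissible N)
    (hz : IsPositiveSteadyState p q z) {a b : ℝ} (ha : 0 < a) (ha1 : a ≤ 1) (hb : 1 ≤ b)
    {x₀ : Fin N → ℝ} (hx₀ : x₀ ∈ Icc (a • z) (b • z)) :
    ∃ x : ℝ → Fin N → ℝ, IsSolution (field p q) x ∧ x 0 = x₀ ∧
      ∀ t, 0 ≤ t → x t ∈ Icc (a • z) (b • z) := by
  have hlh : a • z ≤ b • z := hx₀.1.trans hx₀.2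
  have hsmooth := contDiff_field (q := q) hp
  obtain ⟨K, hK⟩ := (hsmooth.locallyLipschitz.locallyLipschitzOn
    (s := Icc (a • z) (b • z))).exists_lipschitzOnWith_of_compact isCompact_Icc
  obtain ⟨L, hL⟩ := (isCompact_Icc (a := a • z) (b := b • z)).exists_bound_of_continuousOn
    hsmooth.continuous.continuousOn
  -- The clamped field is bounded and globally Lipschitz, hence has global solutions; those that
  -- stay in the box solve the original equation.
  have hlip : LipschitzWith (K * 1) fun x => field p q (boxClamp (a • z) (b • z) x) := by
    rw [← lipschitzOnWith_univ]
    exact hK.comp (lipschitzWith_boxClamp _ _).lipschitzOnWith fun x _ => boxClamp_mem hlh x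
  obtain ⟨x, hx0, hx⟩ := exists_forall_hasDerivWithinAt_Ici (L := L.toNNReal) hlip
    (fun x => (hL _ (boxClamp_mem hlh x)).trans (Real.le_coe_toNNReal L)) x₀
  have hxi := fun i t (ht : 0 ≤ t) => hasDerivWithinAt_pi.1 (hx t ht) i
  have hmem : ∀ t, 0 ≤ t → x t ∈ Icc (a • z) (b • z) := by
    refine fun t ht => ⟨fun i => ?_, fun i => ?_⟩
    · refine le_of_forall_lt_deriv_nonneg (hxi i) (by rw [hx0]; exact hx₀.1 i) (fun s hs hlt => ?_)
        ht
      -- When `x s i` is below the box, its clamped value is exactly `a * z i`, as the comparison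
      -- needs.
      refine field_nonneg_of_mul_le hp hq hz ha ha1 ?_ fun j => (boxClamp_mem hlh (x s)).1 j
      exact max_eq_left ((min_le_right _ _).trans hlt.le)
    · refine neg_le_neg_iff.1 (le_of_forall_lt_deriv_nonneg (y := fun t => -x t i)
        (fun s hs => (hxi i s hs).fun_neg) (neg_le_neg (by rw [hx0]; exact hx₀.2 i))
        (fun s hs hlt => ?_) ht)
      refine neg_nonneg.2 (field_nonpos_of_le_mul hp hq hz hb ?_
        fun j => (boxClamp_mem hlh (x s)).2 j)
      have h1 : min ((b • z) i) (x s i) = (b • z) i := min_eq_left (neg_lt_neg_iff.1 hlt).le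
      simp only [boxClamp, h1]
      exact max_eq_right (hlh i)
  refine ⟨x, fun t ht => ?_, hx0, hmem⟩
  simpa only [boxClamp_of_mem (hmem t ht)] using hx t ht

theorem IsSolution.mem_box (hp : 0 < p) (hq : q ∈ admissible N)
    (hz : IsPositiveSteadyState p q z) {a b : ℝ} (ha : 0 < a) (ha1 : a ≤ 1) (hb : 1 ≤ b)
    {x : ℝ → Fin N → ℝ} (hx : IsSolution (field p q) x) (hx0 : x 0 ∈ Icc (a • z) (b • z))
    {t : ℝ} (ht : 0 ≤ t) : x t ∈ Icc (a • z) (b • z) := by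
  obtain ⟨y, hy, hy0, hmem⟩ := exists_isSolution_mem_box hp hq hz ha ha1 hb hx0
  rw [eq_of_hasDerivWithinAt_Ici (contDiff_field hp).locallyLipschitz hx hy hy0.symm ht]
  exact hmem t ht

/-! ### Exponential decay and convergence -/

theorem sum_sq_le_exp_mul {f : (Fin N → ℝ) → Fin N → ℝ} {x : ℝ → Fin N → ℝ}
    (hx : IsSolution f x) {c : ℝ}
    (hdiss : ∀ t, 0 ≤ t →
      ∑ i, (x t i - z i) * f (x t) i ≤ -(c * ∑ i, (x t i - z i) ^ 2)) {t : ℝ} (ht : 0 ≤ t) :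
    ∑ i, (x t i - z i) ^ 2 ≤ Real.exp (-(2 * c * t)) * ∑ i, (x 0 i - z i) ^ 2 := by
  have hE : ∀ s, 0 ≤ s → HasDerivWithinAt (fun s => ∑ i, (x s i - z i) ^ 2)
      (2 * ∑ i, (x s i - z i) * f (x s) i) (Ici 0) s := by
    intro s hs
    have h1 := HasDerivWithinAt.fun_sum (u := Finset.univ) fun i _ =>
      ((hasDerivWithinAt_pi.1 (hx s hs) i).sub_const (z i)).fun_pow 2
    refine h1.congr_deriv ?_
    rw [Finset.mul_sum]
    exact Finset.sum_congr rfl fun i _ => by push_cast; ring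
  have hexp : ∀ s : ℝ, HasDerivAt (fun s => Real.exp (2 * c * s))
      (Real.exp (2 * c * s) * (2 * c)) s := fun s => by
    simpa using ((hasDerivAt_id s).const_mul (2 * c)).exp
  have hW := fun s (hs : 0 ≤ s) => (hexp s).hasDerivWithinAt.fun_mul (hE s hs)
  have hanti : AntitoneOn (fun s => Real.exp (2 * c * s) * ∑ i, (x s i - z i) ^ 2) (Ici 0) := by
    refine antitoneOn_of_hasDerivWithinAt_nonpos (convex_Ici 0)
      (fun s hs => (hW s hs).continuousWithinAt)
      (fun s hs => (hW s (interior_subset hs)).mono interior_subset) fun s hs => ?_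
    have h2 := hdiss s (interior_subset hs)
    have h3 := Real.exp_pos (2 * c * s)
    nlinarith [mul_le_mul_of_nonneg_left h2 h3.le]
  have h4 := hanti (self_mem_Ici) ht ht
  simp only [mul_zero, Real.exp_zero, one_mul] at h4
  rw [Real.exp_neg, inv_mul_eq_div, le_div_iff₀ (Real.exp_pos _), mul_comm]
  exact h4

theorem exists_exponential_decay (hp : 0 < p) (hq : q ∈ admissible N)
    (hz : IsPositiveSteadyState p q z) {a b : ℝ} (ha : 0 < a) (ha1 : a ≤ 1) (hb : 1 ≤ b) :
    ∃ C r : ℝ, 0 < C ∧ 0 < r ∧ ∀ x : ℝ → Fin N → ℝ, IsSolution (field p q) x →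
      x 0 ∈ Icc (a • z) (b • z) → ∀ t, 0 ≤ t →
        ‖x t - z‖ ≤ C * Real.exp (-r * t) * ‖x 0 - z‖ := by
  obtain ⟨c, hc, hdiss⟩ := exists_dissipation (a := a • z) (b := b • z) hp hq hz
    fun i => mul_pos ha (hz.1 i)
  -- Passing between sup and Euclidean norms costs `√N`; `N + 1` dominates it and is positive even
  -- for `N = 0`.
  refine ⟨N + 1, c, by positivity, hc, fun x hx hx0 t ht => ?_⟩
  have hmem := fun s (hs : 0 ≤ s) => hx.mem_box hp hq hz ha ha1 hb hx0 hs
  have h1 := sum_sq_le_exp_mul hx (fun s hs => hdiss (x s) (hmem s hs).1 (hmem s hs).2) ht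
  have h2 := norm_sq_le_sum_sq (x t - z)
  have h3 := sum_sq_le_card_mul_norm_sq (x 0 - z)
  simp only [Pi.sub_apply] at h2 h3
  refine le_of_sq_le_sq ?_ (by positivity)
  have hexp : Real.exp (-(2 * c * t)) = Real.exp (-c * t) ^ 2 := by
    rw [← Real.exp_nat_mul]
    congr 1
    push_cast
    ring
  rw [hexp] at h1
  calc ‖x t - z‖ ^ 2 ≤ Real.exp (-c * t) ^ 2 * (N * ‖x 0 - z‖ ^ 2) :=
        h2.trans (h1.trans (by gcongr))
    _ ≤ Real.exp (-c * t) ^ 2 * ((N + 1) ^ 2 * ‖x 0 - z‖ ^ 2) := by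
        have : (N : ℝ) ≤ (N + 1) ^ 2 := by nlinarith [Nat.cast_nonneg (α := ℝ) N]
        gcongr
    _ = _ := by ring

theorem isLocallyExponentiallyStable (hp : 0 < p) (hq : q ∈ admissible N)
    (hz : IsPositiveSteadyState p q z) : IsLocallyExponentiallyStable (field p q) z := by
  obtain ⟨C, r, hC, hr, hdecay⟩ := exists_exponential_decay (a := 1 / 2) (b := 2) hp hq hz
    (by norm_num) (by norm_num) (by norm_num)
  have hbox : ∀ᶠ x : Fin N → ℝ in 𝓝 z, ∀ i, x i ∈ Icc (1 / 2 * z i) (2 * z i) := by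
    refine eventually_all.2 fun i => (continuous_apply i).continuousAt.eventually ?_
    have := hz.1 i
    exact Icc_mem_nhds (by linarith) (by linarith)
  obtain ⟨δ, hδ, hball⟩ := Metric.eventually_nhds_iff.1 hbox
  refine ⟨funext hz.2, δ, C, r, hδ, hC, hr, fun x hx hx0 => hdecay x hx ?_⟩
  have h := hball (y := x 0) (by rwa [dist_eq_norm])
  exact ⟨fun i => (h i).1, fun i => (h i).2⟩

theorem exists_mem_box {x : Fin N → ℝ} (hx : x ∈ positiveOrthant N) (hz : z ∈ positiveOrthant N) :
    ∃ a b : ℝ, 0 < a ∧ a ≤ 1 ∧ 1 ≤ b ∧ x ∈ Icc (a • z) (b • z) := by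
  obtain ⟨A, hA⟩ := (finite_range fun i => z i / x i).bddAbove
  obtain ⟨B, hB⟩ := (finite_range fun i => x i / z i).bddAbove
  -- The maximum with `1` places `z` itself in the box.
  refine ⟨(max 1 A)⁻¹, max 1 B, by positivity, inv_le_one_of_one_le₀ (le_max_left _ _),
    le_max_left _ _, fun i => ?_, fun i => ?_⟩
  · have h := (hA (mem_range_self i)).trans (le_max_right 1 A)
    rw [div_le_iff₀ (hx i)] at h
    simpa [inv_mul_le_iff₀ (show 0 < max 1 A by positivity)] using h
  · have h := (hB (mem_range_self i)).trans (le_max_right 1 B)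
    simpa [div_le_iff₀ (hz i)] using h

end OpinionGame

theorem theorem1 (N : ℕ) (p : ℝ) (hp : 0 < p) :
    ∃ xstar : OpinionGame.Params N → (Fin N → ℝ),
      (∃ U : Set (OpinionGame.Params N),
        IsOpen U ∧ OpinionGame.admissible N ⊆ U ∧ ContDiffOn ℝ ∞ xstar U) ∧
      ∀ q ∈ OpinionGame.admissible N,
        OpinionGame.IsPositiveSteadyState p q (xstar q) ∧
        (∀ y : Fin N → ℝ, OpinionGame.IsPositiveSteadyState p q y → y = xstar q) ∧
        OpinionGame.IsLocallyExponentiallyStable (OpinionGame.field p q) (xstar q) ∧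
        OpinionGame.IsNashEquilibrium p q (xstar q) ∧
        (∀ y : Fin N → ℝ, OpinionGame.IsNashEquilibrium p q y → y = xstar q) ∧
        (∀ x₀ ∈ OpinionGame.positiveOrthant N, ∃ x : ℝ → Fin N → ℝ,
          OpinionGame.IsSolution (OpinionGame.field p q) x ∧ x 0 = x₀) ∧
        (∀ x : ℝ → Fin N → ℝ, OpinionGame.IsSolution (OpinionGame.field p q) x →
          x 0 ∈ OpinionGame.positiveOrthant N →
            (∀ t : ℝ, 0 ≤ t → x t ∈ OpinionGame.positiveOrthant N) ∧
            Tendsto x atTop (𝓝 (xstar q))) := by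
  obtain ⟨U, X, hU, hAU, hX, hXs⟩ := OpinionGame.exists_smooth_steadyState (p := p) N hp
  refine ⟨X, ⟨U, hU, hAU, hX⟩, fun q hq => ?_⟩
  have hz := hXs q hq
  refine ⟨hz, fun y hy => hz.eq hp hq hy, OpinionGame.isLocallyExponentiallyStable hp hq hz,
    hz.isNashEquilibrium hp hq, fun y hy => hz.eq hp hq (hy.isPositiveSteadyState hp),
    fun x₀ hx₀ => ?_, fun x hx hx0 => ?_⟩
  · obtain ⟨a, b, ha, ha1, hb, hmem⟩ := OpinionGame.exists_mem_box hx₀ hz.1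
    obtain ⟨x, hx, hx0, -⟩ := OpinionGame.exists_isSolution_mem_box hp hq hz ha ha1 hb hmem
    exact ⟨x, hx, hx0⟩
  · obtain ⟨a, b, ha, ha1, hb, hmem⟩ := OpinionGame.exists_mem_box hx0 hz.1
    refine ⟨fun t ht i => (mul_pos ha (hz.1 i)).trans_le
      ((hx.mem_box hp hq hz ha ha1 hb hmem ht).1 i), ?_⟩
    obtain ⟨C, r, -, hr, hdecay⟩ := OpinionGame.exists_exponential_decay hp hq hz ha ha1 hb
    rw [tendsto_iff_norm_sub_tendsto_zero]
    refine squeeze_zero' (Eventually.of_forall fun _ => norm_nonneg _)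
      ((eventually_ge_atTop 0).mono fun t ht => hdecay x hx hmem t ht) ?_
    have h1 : Tendsto (fun t : ℝ => -r * t) atTop atBot :=
      tendsto_id.const_mul_atTop_of_neg (neg_lt_zero.2 hr)
    simpa using ((Real.tendsto_exp_atBot.comp h1).const_mul C).mul_const ‖x 0 - X q‖
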